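/- Let $\epsilon>0$. There is a constant $C>0$, depending only on $\epsilon$, such that the following holds for every $n$ and every fixed $\mathbf e=[e_1;\dots;e_n]\in\{0,1\}^n$. Let $B_1,\dots,B_n$ be independent random integers, each uniformly distributed on $\{1,\dots,B\}$ with $B=\lfloor 2^{(1/2+\epsilon)n^2}\rfloor$, and let $B_0=\sum_{i=1}^n B_ie_i$ (no assumption that $B_0\ge\frac12\sum_i B_i$ is made). Let $L\subset\mathbb Z^{n+2}$ be the lattice generated by the columns of the $(n+2)\times(n+1)$ matrix $$\begin{pmatrix}B_0&-B_1&-B_2&\cdots&-B_n\\1&0&0&\cdots&0\\0&1&0&\cdots&0\\0&0&1&\cdots&0\\\vdots&\vdots&\vdots&\ddots&\vdots\\0&0&0&\cdots&1\end{pmatrix},$$ whose first row is $(B_0,-B_1,\dots,-B_n)$ and whose remaining rows form the identity matrix of size $n+1$. Then: 1. with probability at least $1-C\,2^{-\epsilon n^2/2}$, the LLL algorithm (with the parameter $3/4$), run on the columns of this matrix in the given order, terminates and the first vector of the basis that it outputs is a nonzero integer multiple of $[0;1;\mathbf e]$; 2. with $m=2\cdot2^{n/2}n^{1/2}$, the probability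 that $L$ contains a vector $\mathbf x$ with Euclidean norm $\|\mathbf x\|\le m$ which is not an integer multiple of $[0;1;\mathbf e]$ is at most $C\,2^{-\epsilon n^2/2}$. -/

import Mathlib

open MeasureTheory ProbabilityTheory

/-- An integer vector, viewed in Euclidean space (so that its norm is the Euclidean norm). -/
noncomputable def toEuclid {d : ℕ} (x : Fin d → ℤ) : EuclideanSpace ℝ (Fin d) :=
  WithLp.toLp 2 (fun i => (x i : ℝ))

/-! ### The LLL algorithm (parameter 3/4) on a family of `N` integer vectors -/

/-- The Gram-Schmidt vector `b*_i` of the family `b`. -/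
noncomputable def gsVec {N d : ℕ} (b : Fin N → Fin d → ℤ) (i : Fin N) :
    EuclideanSpace ℝ (Fin d) :=
  InnerProductSpace.gramSchmidt ℝ (fun j => toEuclid (b j)) i

/-- The Gram-Schmidt coefficient `μ_{i,j} = ⟨b_i, b*_j⟩ / ‖b*_j‖²`. -/
noncomputable def gsCoeff {N d : ℕ} (b : Fin N → Fin d → ℤ) (i j : Fin N) : ℝ :=
  inner ℝ (toEuclid (b i)) (gsVec b j) / ‖gsVec b j‖ ^ 2

open Classical in
/-- Size reduction of `b_k` against `b_l`: if `|μ_{k,l}| > 1/2`, subtract from `b_k` the nearest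
integer to `μ_{k,l}` times `b_l`. -/
noncomputable def sizeReduce {N d : ℕ} (k : Fin N) (b : Fin N → Fin d → ℤ) (l : Fin N) :
    Fin N → Fin d → ℤ :=
  if 1 / 2 < |gsCoeff b k l| then
    Function.update b k (b k - round (gsCoeff b k l) • b l)
  else b

/-- A state of the algorithm: the current family and a counter. With vectors indexed from `0`, the
counter `pos` means that the vectors number `pos` and `pos + 1` are the next to be treated. -/
structure LLLState (N d : ℕ) where
  basis : Fin N → Fin d → ℤ
  pos : ℕ

/-- The algorithm has halted when there is no vector number `pos + 1`. -/
def LLLState.Halted {N d : ℕ} (s : LLLState N d) : Prop := ¬ s.pos + 1 < N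

open Classical in
/-- One pass through the main loop. First `b_{pos+1}` is size-reduced against `b_pos`. If the
Lovász condition then fails, the two vectors are swapped and the counter goes down by one (it
stays at `0` if it is `0`); otherwise `b_{pos+1}` is size-reduced against `b_{pos-1}, …, b_0`, in
this order, and the counter goes up by one. A halted state is left unchanged. -/
noncomputable def LLLState.step {N d : ℕ} (s : LLLState N d) : LLLState N d :=
  if h : s.pos + 1 < N then
    let p : Fin N := ⟨s.pos, Nat.lt_of_succ_lt h⟩
    let q : Fin N := ⟨s.pos + 1, h⟩
    let b := sizeReduce q s.basis p
    if ‖gsVec b q‖ ^ 2 < (3 / 4 - gsCoeff b q p ^ 2) * ‖gsVec b p‖ ^ 2 then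
      { basis := b ∘ Equiv.swap p q, pos := s.pos - 1 }
    else
      { basis := (((List.finRange N).filter (fun l => l < p)).reverse).foldl (sizeReduce q) b
        pos := s.pos + 1 }
  else s

/-- The LLL algorithm, started on the family `b`, halts after finitely many passes, and the first
vector of the final family is `v`. -/
def LLLReturns {N d : ℕ} [NeZero N] (b : Fin N → Fin d → ℤ) (v : Fin d → ℤ) : Prop :=
  ∃ t : ℕ, (LLLState.step^[t] { basis := b, pos := 0 }).Halted ∧
    (LLLState.step^[t] { basis := b, pos := 0 }).basis 0 = v

/-! ### The lattice of a subset sum problem -/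

/-- The `(n+2) × (n+1)` matrix with first row `(B₀, -B₁, …, -Bₙ)` and the identity matrix below
it (so that its second row is `(1, 0, …, 0)`). -/
def subsetSumMatrix {n : ℕ} (B₀ : ℤ) (B : Fin n → ℤ) : Matrix (Fin (n + 2)) (Fin (n + 1)) ℤ :=
  Matrix.of (Fin.cons (Fin.cons B₀ (fun i => -B i))
    (fun i j => (1 : Matrix (Fin (n + 1)) (Fin (n + 1)) ℤ) i j))

/-- The `j`-th column of the matrix. -/
def subsetSumCol {n : ℕ} (B₀ : ℤ) (B : Fin n → ℤ) (j : Fin (n + 1)) : Fin (n + 2) → ℤ :=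
  fun i => subsetSumMatrix B₀ B i j

/-- The integer lattice generated by the columns of the matrix. -/
def subsetSumLattice {n : ℕ} (B₀ : ℤ) (B : Fin n → ℤ) : Submodule ℤ (Fin (n + 2) → ℤ) :=
  Submodule.span ℤ (Set.range (subsetSumCol B₀ B))

/-- The vector `[0; 1; e]`. -/
def solutionVec {n : ℕ} (e : Fin n → ℤ) : Fin (n + 2) → ℤ :=
  Fin.cons 0 (Fin.cons 1 e)

/-!
LLL approximates a shortest nonzero vector of a lattice of rank `n + 1` within the factor
`2 ^ (n / 2)`. As the solution vector `[0; 1; e]` has norm at most `√(n + 1)`, the vector that LLL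
returns has norm at most `m = 2 · 2 ^ (n / 2) · √n` (for `n ≥ 1`). The first claim therefore follows
from the second one, which says that with high probability all lattice vectors of norm at most `m`
are multiples of the solution vector.

*LLL* (`exists_LLLReturns`). Size reduction does not change the Gram-Schmidt vectors
(`gsVec_sizeReduce`), and a swap of the vectors `p` and `p + 1` changes, among the determinants of
the Gram matrices of the initial segments of the family, only the one that ends in `p`, which it
lowers (`gramDet_comp_swap_of_ne`, `gramDet_comp_swap_self_lt`). These determinants are products of
squared lengths of Gram-Schmidt vectors (`cast_gramDet`) and natural numbers, so there are only
finitely many swaps, and the algorithm halts. At that moment the squared length of a Gram-Schmidt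
vector at most halves from one to the next, while each nonzero lattice vector is at least as long
as one of them (`exists_norm_gsVec_le`); this gives the approximation factor.

*Short vectors* (`measureReal_exists_short_vector_le`). A lattice vector `x` satisfies
`∑ B_i z_i = x 0` with `z_i = x 1 * e_i - x_{i+2}`, and it is a multiple of the solution vector if
`z = 0`. If `z_k ≠ 0`, then, given the other `B_i`, at most one value of `B_k` fulfils the equation,
so that its probability is at most `1 / ⌊2 ^ ((1 / 2 + ε) n²)⌋`. The integer vectors of norm at
most `m` lie in a cube with at most `(2 m + 1) ^ (n + 2) = 2 ^ (n² / 2 + O(n log n))` integer points,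
and the union bound over them gives `O(2 ^ (-ε n² / 2))` (`exists_pow_le_const_mul_rpow`).
-/

/-! ### Elementary operations on a family of vectors -/

theorem span_update_sub_smul {ι R M : Type*} [DecidableEq ι] [Ring R] [AddCommGroup M]
    [Module R M] (f : ι → M) {k l : ι} (hkl : l ≠ k) (r : R) {S : Set ι} (hS : k ∈ S → l ∈ S) :
    Submodule.span R (Function.update f k (f k - r • f l) '' S) = Submodule.span R (f '' S) := by
  have key : ∀ (f : ι → M) (r : R),
      Submodule.span R (Function.update f k (f k - r • f l) '' S) ≤ Submodule.span R (f '' S) := by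
    intro f r
    rw [Submodule.span_le]
    rintro _ ⟨i, hi, rfl⟩
    by_cases hik : i = k
    · subst hik
      rw [Function.update_self]
      exact Submodule.sub_mem _ (Submodule.subset_span ⟨i, hi, rfl⟩)
        (Submodule.smul_mem _ _ (Submodule.subset_span ⟨l, hS hi, rfl⟩))
    · rw [Function.update_of_ne hik]
      exact Submodule.subset_span ⟨i, hi, rfl⟩
  refine le_antisymm (key f r) ?_
  -- `f` is recovered by the inverse operation, which adds `r • f l` back
  have h := key (Function.update f k (f k - r • f l)) (-r)
  simpa [Function.update_of_ne hkl] using h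

theorem toEuclid_sub_smul {d : ℕ} (x y : Fin d → ℤ) (r : ℤ) :
    toEuclid (x - r • y) = toEuclid x - (r : ℝ) • toEuclid y := by
  ext i
  simp [toEuclid]

theorem inner_toEuclid {d : ℕ} (x y : Fin d → ℤ) :
    inner ℝ (toEuclid x) (toEuclid y) = ((∑ i, x i * y i : ℤ) : ℝ) := by
  simp [toEuclid, PiLp.inner_apply, mul_comm]

theorem toEuclid_comp_update {N d : ℕ} (b : Fin N → Fin d → ℤ) (k l : Fin N) (r : ℤ) :
    (fun j => toEuclid (Function.update b k (b k - r • b l) j)) =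
      Function.update (fun j => toEuclid (b j)) k
        (toEuclid (b k) - (r : ℝ) • toEuclid (b l)) := by
  funext j
  by_cases h : j = k
  · subst h
    rw [Function.update_self, Function.update_self, toEuclid_sub_smul]
  · simp [Function.update_of_ne h]

/-! ### Gram-Schmidt vectors -/

section GramSchmidt

open InnerProductSpace

variable {E ι : Type*} [NormedAddCommGroup E] [InnerProductSpace ℝ E] [LinearOrder ι]
  [LocallyFiniteOrderBot ι] [WellFoundedLT ι]

theorem inner_gramSchmidt_eq_zero_of_mem_span (f : ι → E) (i : ι) {u : E}
    (hu : u ∈ Submodule.span ℝ (f '' Set.Iio i)) : inner ℝ u (gramSchmidt ℝ f i) = 0 := by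
  induction hu using Submodule.span_induction with
  | mem x hx =>
    obtain ⟨j, hj, rfl⟩ := hx
    rw [real_inner_comm]
    exact gramSchmidt_inv_triangular ℝ f hj
  | zero => simp
  | add x y _ _ hx hy => rw [inner_add_left, hx, hy, add_zero]
  | smul a x _ hx => rw [inner_smul_left, hx, mul_zero]

theorem sub_gramSchmidt_mem_span (f : ι → E) (i : ι) :
    f i - gramSchmidt ℝ f i ∈ Submodule.span ℝ (f '' Set.Iio i) := by
  rw [← span_gramSchmidt_Iio ℝ f i, sub_eq_of_eq_add' (gramSchmidt_def'' ℝ f i)]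
  refine Submodule.sum_mem _ fun j hj => Submodule.smul_mem _ _ (Submodule.subset_span ⟨j, ?_, rfl⟩)
  simpa using hj

/-- The `i`-th Gram-Schmidt vector is the only vector orthogonal to the preceding vectors of the
family whose difference to `f i` lies in their span. -/
theorem gramSchmidt_eq_of_mem_span (f : ι → E) (i : ι) {v : E}
    (hmem : f i - v ∈ Submodule.span ℝ (f '' Set.Iio i))
    (horth : ∀ u ∈ Submodule.span ℝ (f '' Set.Iio i), inner ℝ u v = 0) :
    gramSchmidt ℝ f i = v := by
  have h := Submodule.sub_mem _ hmem (sub_gramSchmidt_mem_span f i)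
  rw [sub_sub_sub_cancel_left] at h
  have h0 : inner ℝ (gramSchmidt ℝ f i - v) (gramSchmidt ℝ f i - v) = 0 := by
    rw [inner_sub_right, horth _ h, inner_gramSchmidt_eq_zero_of_mem_span f i h, sub_zero]
  exact sub_eq_zero.1 (inner_self_eq_zero.1 h0)

theorem gramSchmidt_congr_of_span_eq {f g : ι → E} {i : ι}
    (hspan : Submodule.span ℝ (g '' Set.Iio i) = Submodule.span ℝ (f '' Set.Iio i))
    (hsub : g i - f i ∈ Submodule.span ℝ (f '' Set.Iio i)) :
    gramSchmidt ℝ g i = gramSchmidt ℝ f i := by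
  refine gramSchmidt_eq_of_mem_span g i ?_ ?_ <;> rw [hspan]
  · have := Submodule.add_mem _ hsub (sub_gramSchmidt_mem_span f i)
    simpa using this
  · exact fun u hu => inner_gramSchmidt_eq_zero_of_mem_span f i hu

theorem inner_gramSchmidt_self_right (f : ι → E) (i : ι) :
    inner ℝ (f i) (gramSchmidt ℝ f i) = ‖gramSchmidt ℝ f i‖ ^ 2 := by
  have h := inner_gramSchmidt_eq_zero_of_mem_span f i (sub_gramSchmidt_mem_span f i)
  rw [inner_sub_left, sub_eq_zero, real_inner_self_eq_norm_sq] at h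
  exact h

/-- Entry of the factorisation `G = M D Mᵀ` of a Gram matrix, where `M` holds the Gram-Schmidt
coefficients and `D` the squared lengths of the Gram-Schmidt vectors. -/
theorem inner_eq_sum_gramSchmidt (f : ι → E) {i a c : ι} (ha : a ≤ i) [Fintype {j // j ≤ i}] :
    inner ℝ (f a) (f c) = ∑ k : {j // j ≤ i},
      inner ℝ (f a) (gramSchmidt ℝ f k) / ‖gramSchmidt ℝ f k‖ ^ 2 * ‖gramSchmidt ℝ f k‖ ^ 2 *
        (inner ℝ (f c) (gramSchmidt ℝ f k) / ‖gramSchmidt ℝ f k‖ ^ 2) := by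
  have hsum : ∀ F : ι → ℝ, (∀ k, a < k → F k = 0) →
      ∑ k : {j // j ≤ i}, F k = F a + ∑ k ∈ Finset.Iio a, F k := by
    intro F hF
    rw [← Finset.sum_subtype (Finset.Iic i) (by simp) F, add_comm (F a),
      Finset.sum_Iio_add_eq_sum_Iic a]
    refine (Finset.sum_subset (Finset.Iic_subset_Iic.2 ha) fun k _ hk => hF k ?_).symm
    simpa using hk
  rw [hsum (fun k => inner ℝ (f a) (gramSchmidt ℝ f k) / ‖gramSchmidt ℝ f k‖ ^ 2 *
    ‖gramSchmidt ℝ f k‖ ^ 2 * (inner ℝ (f c) (gramSchmidt ℝ f k) / ‖gramSchmidt ℝ f k‖ ^ 2))]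
  · conv_lhs => rw [gramSchmidt_def'' ℝ f a]
    rw [inner_add_left, sum_inner]
    congr 1
    · rw [inner_gramSchmidt_self_right, real_inner_comm]
      by_cases h : gramSchmidt ℝ f a = 0
      · simp [h]
      · have : ‖gramSchmidt ℝ f a‖ ≠ 0 := norm_ne_zero_iff.2 h
        field_simp
    · refine Finset.sum_congr rfl fun k _ => ?_
      rw [inner_smul_left, real_inner_comm (f a), real_inner_comm (f c)]
      by_cases h : gramSchmidt ℝ f k = 0
      · simp [h]
      · have : ‖gramSchmidt ℝ f k‖ ≠ 0 := norm_ne_zero_iff.2 h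
        simp
        field_simp
  · intro k hk
    rw [real_inner_comm, gramSchmidt_inv_triangular ℝ f hk]
    simp

/-- The determinant of the Gram matrix of the vectors up to `i` is the product of the squared
lengths of the Gram-Schmidt vectors up to `i`; no linear independence is needed. -/
theorem det_gram_eq_prod_norm_gramSchmidt (f : ι → E) (i : ι) [Fintype {j // j ≤ i}] :
    (Matrix.of fun a c : {j // j ≤ i} => (inner ℝ (f a) (f c) : ℝ)).det =
      ∏ j : {j // j ≤ i}, ‖gramSchmidt ℝ f j‖ ^ 2 := by
  set M : Matrix {j // j ≤ i} {j // j ≤ i} ℝ := Matrix.of fun a k =>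
    inner ℝ (f a) (gramSchmidt ℝ f k) / ‖gramSchmidt ℝ f k‖ ^ 2 with hM
  have hfac : (Matrix.of fun a c : {j // j ≤ i} => (inner ℝ (f a) (f c) : ℝ)) =
      M * Matrix.diagonal (fun j : {j // j ≤ i} => ‖gramSchmidt ℝ f j‖ ^ 2) * M.transpose := by
    ext a c
    rw [Matrix.mul_apply]
    simp only [Matrix.mul_diagonal, Matrix.transpose_apply, hM, Matrix.of_apply]
    exact inner_eq_sum_gramSchmidt f a.2
  have hdet : M.det = ∏ j, M j j := by
    apply Matrix.det_of_isLowerTriangular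
    intro a c hac
    have hac' : (a : ι) < c := hac
    simp only [hM, Matrix.of_apply]
    rw [real_inner_comm, gramSchmidt_inv_triangular ℝ f hac', zero_div]
  rw [hfac, Matrix.det_mul, Matrix.det_mul, Matrix.det_transpose, Matrix.det_diagonal, hdet,
    ← Finset.prod_mul_distrib, ← Finset.prod_mul_distrib]
  refine Finset.prod_congr rfl fun j _ => ?_
  simp only [hM, Matrix.of_apply]
  rw [inner_gramSchmidt_self_right]
  -- the diagonal entries of `M` are `1`, except where the Gram-Schmidt vector vanishes
  by_cases h : gramSchmidt ℝ f (j : ι) = 0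
  · simp [h]
  · have : ‖gramSchmidt ℝ f (j : ι)‖ ≠ 0 := norm_ne_zero_iff.2 h
    field_simp

end GramSchmidt

/-! ### Size reduction and swaps -/

section Reduction

variable {N d : ℕ}

theorem gsVec_sizeReduce (b : Fin N → Fin d → ℤ) {k l : Fin N} (hlk : l < k) (i : Fin N) :
    gsVec (sizeReduce k b l) i = gsVec b i := by
  unfold sizeReduce
  split_ifs
  swap
  · rfl
  unfold gsVec
  rw [toEuclid_comp_update]
  refine gramSchmidt_congr_of_span_eq
    (span_update_sub_smul (fun j => toEuclid (b j)) hlk.ne _ fun hk => lt_trans hlk hk) ?_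
  by_cases hik : i = k
  · subst hik
    rw [Function.update_self, sub_sub_cancel_left]
    exact Submodule.neg_mem _ (Submodule.smul_mem _ _ (Submodule.subset_span ⟨l, hlk, rfl⟩))
  · rw [Function.update_of_ne hik, sub_self]
    exact Submodule.zero_mem _

theorem span_sizeReduce (b : Fin N → Fin d → ℤ) {k l : Fin N} (hlk : l < k) :
    Submodule.span ℤ (Set.range (sizeReduce k b l)) = Submodule.span ℤ (Set.range b) := by
  unfold sizeReduce
  split_ifs
  · rw [← Set.image_univ, ← Set.image_univ]
    exact span_update_sub_smul b hlk.ne _ fun _ => Set.mem_univ _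
  · rfl

theorem foldl_sizeReduce (k : Fin N) (ls : List (Fin N)) (hls : ∀ l ∈ ls, l < k)
    (b : Fin N → Fin d → ℤ) :
    gsVec (ls.foldl (sizeReduce k) b) = gsVec b ∧
      Submodule.span ℤ (Set.range (ls.foldl (sizeReduce k) b)) =
        Submodule.span ℤ (Set.range b) := by
  induction ls generalizing b with
  | nil => exact ⟨rfl, rfl⟩
  | cons l ls ih =>
    have hl := hls l List.mem_cons_self
    obtain ⟨h1, h2⟩ := ih (fun m hm => hls m (List.mem_cons_of_mem _ hm)) (sizeReduce k b l)
    refine ⟨?_, ?_⟩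
    · rw [List.foldl_cons, h1]
      exact funext (gsVec_sizeReduce b hl)
    · rw [List.foldl_cons, h2, span_sizeReduce b hl]

theorem gsCoeff_sizeReduce_sq_le (b : Fin N → Fin d → ℤ) {k l : Fin N} (hlk : l < k) :
    gsCoeff (sizeReduce k b l) k l ^ 2 ≤ 1 / 4 := by
  suffices h : |gsCoeff (sizeReduce k b l) k l| ≤ 1 / 2 by
    rw [← sq_abs]
    nlinarith [abs_nonneg (gsCoeff (sizeReduce k b l) k l)]
  by_cases hμ : 1 / 2 < |gsCoeff b k l|
  swap
  · rw [sizeReduce, if_neg hμ]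
    exact not_lt.1 hμ
  have hne : gsVec b l ≠ 0 := by
    intro h0
    rw [gsCoeff, h0] at hμ
    norm_num at hμ
  have hself : inner ℝ (toEuclid (b l)) (gsVec b l) = ‖gsVec b l‖ ^ 2 :=
    inner_gramSchmidt_self_right (fun j => toEuclid (b j)) l
  have hval : gsCoeff (sizeReduce k b l) k l = gsCoeff b k l - round (gsCoeff b k l) := by
    conv_lhs => rw [gsCoeff, gsVec_sizeReduce b hlk, sizeReduce, if_pos hμ, Function.update_self,
      toEuclid_sub_smul, inner_sub_left, inner_smul_left, hself]
    have : ‖gsVec b l‖ ≠ 0 := norm_ne_zero_iff.2 hne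
    simp only [gsCoeff, conj_trivial]
    field_simp
  rw [hval]
  exact abs_sub_round _

theorem gsVec_comp_swap_left (b : Fin N → Fin d → ℤ) {p q : Fin N} (hpq : (p : ℕ) + 1 = q) :
    gsVec (b ∘ Equiv.swap p q) p = gsVec b q + gsCoeff b q p • gsVec b p := by
  have hlt : p < q := Fin.lt_def.2 (by omega)
  have himg : (fun j => toEuclid ((b ∘ Equiv.swap p q) j)) '' Set.Iio p =
      (fun j => toEuclid (b j)) '' Set.Iio p := by
    refine Set.image_congr fun j hj => ?_
    have hj' : j < p := hj
    simp [Equiv.swap_apply_of_ne_of_ne hj'.ne (hj'.trans hlt).ne]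
  refine gramSchmidt_eq_of_mem_span _ p ?_ ?_ <;> rw [himg]
  · have hdef := InnerProductSpace.gramSchmidt_def'' ℝ (fun j => toEuclid (b j)) q
    have hins : Finset.Iio q = insert p (Finset.Iio p) := by
      ext j
      simp only [Finset.mem_Iio, Finset.mem_insert, Fin.lt_def, Fin.ext_iff]
      omega
    rw [hins, Finset.sum_insert (by simp)] at hdef
    rw [← InnerProductSpace.span_gramSchmidt_Iio ℝ (fun j => toEuclid (b j)) p]
    have hcoeff : gsCoeff b q p • gsVec b p =
        (inner ℝ (gsVec b p) (toEuclid (b q)) / ‖gsVec b p‖ ^ 2) • gsVec b p := by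
      rw [gsCoeff, real_inner_comm]
    have hsub : toEuclid ((b ∘ Equiv.swap p q) p) -
          (gsVec b q + gsCoeff b q p • gsVec b p) =
        ∑ j ∈ Finset.Iio p, (inner ℝ (gsVec b j) (toEuclid (b q)) / ‖gsVec b j‖ ^ 2) •
          gsVec b j := by
      rw [Function.comp_apply, Equiv.swap_apply_left, hcoeff, sub_eq_iff_eq_add', add_assoc]
      exact hdef
    rw [hsub]
    refine Submodule.sum_mem _ fun j hj =>
      Submodule.smul_mem _ _ (Submodule.subset_span ⟨j, ?_, rfl⟩)
    simpa using hj
  · intro u hu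
    have h1 : inner ℝ u (gsVec b p) = 0 := inner_gramSchmidt_eq_zero_of_mem_span _ p hu
    have h2 : inner ℝ u (gsVec b q) = 0 := inner_gramSchmidt_eq_zero_of_mem_span _ q
      (Submodule.span_mono (Set.image_mono (Set.Iio_subset_Iio hlt.le)) hu)
    rw [inner_add_right, inner_smul_right, h1, h2]
    simp

theorem norm_gsVec_comp_swap_left (b : Fin N → Fin d → ℤ) {p q : Fin N}
    (hpq : (p : ℕ) + 1 = q) :
    ‖gsVec (b ∘ Equiv.swap p q) p‖ ^ 2 =
      ‖gsVec b q‖ ^ 2 + gsCoeff b q p ^ 2 * ‖gsVec b p‖ ^ 2 := by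
  have hne : q ≠ p := by
    rintro rfl
    omega
  have horth : inner ℝ (gsVec b q) (gsVec b p) = 0 :=
    InnerProductSpace.gramSchmidt_orthogonal ℝ _ hne
  rw [gsVec_comp_swap_left b hpq, norm_add_sq_real, inner_smul_right, horth, norm_smul, mul_pow,
    Real.norm_eq_abs, sq_abs]
  ring

theorem gsVec_comp_swap_of_lt (b : Fin N → Fin d → ℤ) {p q i : Fin N} (hpq : p < q)
    (hi : i < p) : gsVec (b ∘ Equiv.swap p q) i = gsVec b i := by
  have hfix : ∀ j ≤ i, Equiv.swap p q j = j := fun j hj =>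
    Equiv.swap_apply_of_ne_of_ne (hj.trans_lt hi).ne ((hj.trans_lt hi).trans hpq).ne
  refine gramSchmidt_congr_of_span_eq ?_ ?_
  · congr 1
    exact Set.image_congr fun j hj => by simp [hfix j (le_of_lt hj)]
  · simp [hfix i le_rfl]

/-! ### Gram determinants -/

/-- The determinant of the Gram matrix of the vectors `b 0, …, b i`, an integer. -/
def gramDet (b : Fin N → Fin d → ℤ) (i : Fin N) : ℤ :=
  (Matrix.of fun a c : {j // j ≤ i} => ∑ k, b a k * b c k).det

theorem cast_gramDet (b : Fin N → Fin d → ℤ) (i : Fin N) :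
    (gramDet b i : ℝ) = ∏ j ∈ Finset.Iic i, ‖gsVec b j‖ ^ 2 := by
  have h := det_gram_eq_prod_norm_gramSchmidt (fun j => toEuclid (b j)) i
  rw [← Finset.prod_subtype (Finset.Iic i) (by simp)
    (fun j => ‖InnerProductSpace.gramSchmidt ℝ (fun j => toEuclid (b j)) j‖ ^ 2)] at h
  rw [gramDet, Int.cast_det]
  refine Eq.trans (congrArg Matrix.det ?_) h
  ext a c
  simp [inner_toEuclid]

theorem gramDet_nonneg (b : Fin N → Fin d → ℤ) (i : Fin N) : 0 ≤ gramDet b i := by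
  have : (0 : ℝ) ≤ gramDet b i := by
    rw [cast_gramDet]
    positivity
  exact_mod_cast this

theorem gramDet_ne_zero_iff (b : Fin N → Fin d → ℤ) (i : Fin N) :
    gramDet b i ≠ 0 ↔ ∀ j ≤ i, gsVec b j ≠ 0 := by
  rw [← Int.cast_ne_zero (α := ℝ), cast_gramDet, Finset.prod_ne_zero_iff]
  simp

theorem gramDet_congr_of_gsVec_eq {b b' : Fin N → Fin d → ℤ} (h : gsVec b' = gsVec b) :
    gramDet b' = gramDet b := by
  funext i
  rw [← Int.cast_inj (α := ℝ), cast_gramDet, cast_gramDet, h]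

/-- A swap of the neighbours `p` and `q` only permutes the vectors up to `i`, unless `i = p`. -/
theorem gramDet_comp_swap_of_ne (b : Fin N → Fin d → ℤ) {p q i : Fin N}
    (hpq : (p : ℕ) + 1 = q) (hi : i ≠ p) :
    gramDet (b ∘ Equiv.swap p q) i = gramDet b i := by
  have hmem : ∀ j, Equiv.swap p q j ≤ i ↔ j ≤ i := by
    intro j
    rw [Equiv.swap_apply_def]
    simp only [Fin.ext_iff, Fin.le_def, ne_eq] at *
    split_ifs <;> omega
  unfold gramDet
  rw [← Matrix.det_submatrix_equiv_self ((Equiv.swap p q).subtypePerm hmem)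
    (Matrix.of fun a c : {j // j ≤ i} => ∑ k, b a k * b c k)]
  rfl

theorem gramDet_comp_swap_self_lt (b : Fin N → Fin d → ℤ) {p q : Fin N}
    (hpq : (p : ℕ) + 1 = q) (hne : ∀ i, gsVec b i ≠ 0)
    (hlov : ‖gsVec b q‖ ^ 2 < (3 / 4 - gsCoeff b q p ^ 2) * ‖gsVec b p‖ ^ 2) :
    gramDet (b ∘ Equiv.swap p q) p < gramDet b p := by
  have hlt : p < q := Fin.lt_def.2 (by omega)
  rw [← Int.cast_lt (R := ℝ), cast_gramDet, cast_gramDet, ← Finset.Iio_insert,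
    Finset.prod_insert (by simp), Finset.prod_insert (by simp),
    Finset.prod_congr rfl fun j hj => by
      rw [gsVec_comp_swap_of_lt b hlt (Finset.mem_Iio.1 hj)]]
  refine mul_lt_mul_of_pos_right ?_ (Finset.prod_pos fun j _ => ?_)
  · rw [norm_gsVec_comp_swap_left b hpq]
    nlinarith [sq_nonneg ‖gsVec b p‖]
  · have := norm_pos_iff.2 (hne j)
    positivity

theorem gsVec_comp_swap_ne_zero (b : Fin N → Fin d → ℤ) {p q : Fin N}
    (hpq : (p : ℕ) + 1 = q) (hne : ∀ i, gsVec b i ≠ 0) (i : Fin N) :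
    gsVec (b ∘ Equiv.swap p q) i ≠ 0 := by
  have hmax : max i q ≠ p := by
    have : p < q := Fin.lt_def.2 (by omega)
    exact (this.trans_le (le_max_right i q)).ne'
  refine (gramDet_ne_zero_iff (b ∘ Equiv.swap p q) (max i q)).1 ?_ i (le_max_left i q)
  rw [gramDet_comp_swap_of_ne b hpq hmax]
  exact (gramDet_ne_zero_iff b _).2 fun j _ => hne j

/-- The potential of the algorithm: the sum of the Gram determinants. It is a natural number, so
that it can decrease only finitely often. -/
def gramPotential (b : Fin N → Fin d → ℤ) : ℕ := ∑ i, (gramDet b i).toNat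

theorem gramPotential_comp_swap_lt (b : Fin N → Fin d → ℤ) {p q : Fin N}
    (hpq : (p : ℕ) + 1 = q) (hne : ∀ i, gsVec b i ≠ 0)
    (hlov : ‖gsVec b q‖ ^ 2 < (3 / 4 - gsCoeff b q p ^ 2) * ‖gsVec b p‖ ^ 2) :
    gramPotential (b ∘ Equiv.swap p q) < gramPotential b := by
  have hp := gramDet_comp_swap_self_lt b hpq hne hlov
  have h0 := gramDet_nonneg (b ∘ Equiv.swap p q) p
  refine Finset.sum_lt_sum (fun i _ => ?_) ⟨p, Finset.mem_univ _, by omega⟩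
  by_cases hi : i = p
  · subst hi
    omega
  · rw [gramDet_comp_swap_of_ne b hpq hi]

/-! ### Correctness of the LLL algorithm -/

/-- The invariant of the main loop: the family is a basis of `Λ`, and as far as the counter has
come, the squared length of a Gram-Schmidt vector at most halves from one to the next. -/
structure LLLState.Invariant (Λ : Submodule ℤ (Fin d → ℤ)) (s : LLLState N d) : Prop where
  span_eq : Submodule.span ℤ (Set.range s.basis) = Λ
  gsVec_ne_zero : ∀ i, gsVec s.basis i ≠ 0
  norm_le : ∀ i j : Fin N, (i : ℕ) + 1 = j → (j : ℕ) ≤ s.pos →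
    ‖gsVec s.basis i‖ ^ 2 ≤ 2 * ‖gsVec s.basis j‖ ^ 2

theorem LLLState.Invariant.step {Λ : Submodule ℤ (Fin d → ℤ)} {s : LLLState N d}
    (hs : s.Invariant Λ) (h : ¬ s.Halted) :
    s.step.Invariant Λ ∧ (gramPotential s.step.basis < gramPotential s.basis ∨
      gramPotential s.step.basis = gramPotential s.basis ∧ s.step.pos = s.pos + 1) := by
  have hN : s.pos + 1 < N := not_not.1 h
  obtain ⟨hspan, hne, hnorm⟩ := hs
  set p : Fin N := ⟨s.pos, Nat.lt_of_succ_lt hN⟩ with hp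
  set q : Fin N := ⟨s.pos + 1, hN⟩ with hq
  have hpq : (p : ℕ) + 1 = q := rfl
  have hlt : p < q := Fin.lt_def.2 (by omega)
  set b := sizeReduce q s.basis p with hb
  have hgs : gsVec b = gsVec s.basis := funext (gsVec_sizeReduce s.basis hlt)
  have hbspan : Submodule.span ℤ (Set.range b) = Λ := (span_sizeReduce s.basis hlt).trans hspan
  have hpot : gramPotential b = gramPotential s.basis := by
    unfold gramPotential
    rw [gramDet_congr_of_gsVec_eq hgs]
  have hbne : ∀ i, gsVec b i ≠ 0 := by rwa [hgs]
  by_cases hlov : ‖gsVec b q‖ ^ 2 < (3 / 4 - gsCoeff b q p ^ 2) * ‖gsVec b p‖ ^ 2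
  · have hstep : s.step = { basis := b ∘ Equiv.swap p q, pos := s.pos - 1 } := by
      unfold LLLState.step
      rw [dif_pos hN]
      exact if_pos hlov
    rw [hstep]
    refine ⟨⟨?_, gsVec_comp_swap_ne_zero b hpq hbne, ?_⟩, Or.inl ?_⟩
    · rw [← hbspan]
      congr 1
      exact (Equiv.swap p q).surjective.range_comp b
    · intro i j hij hj
      have hjp : j < p := by
        rw [Fin.lt_def]
        simp only [hp] at *
        omega
      have hip : i < p := lt_trans (Fin.lt_def.2 (by omega)) hjp
      simp only
      rw [gsVec_comp_swap_of_lt b hlt hip, gsVec_comp_swap_of_lt b hlt hjp, hgs]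
      exact hnorm i j hij (by simp only at hj; omega)
    · rw [← hpot]
      exact gramPotential_comp_swap_lt b hpq hbne hlov
  · have hstep : s.step =
        { basis := (((List.finRange N).filter (fun l => l < p)).reverse).foldl (sizeReduce q) b
          pos := s.pos + 1 } := by
      unfold LLLState.step
      rw [dif_pos hN]
      exact if_neg hlov
    obtain ⟨hgs', hspan'⟩ := foldl_sizeReduce q
      (((List.finRange N).filter (fun l => l < p)).reverse) (fun l hl => by
        simp only [List.mem_reverse, List.mem_filter, decide_eq_true_eq] at hl
        exact hl.2.trans hlt) b
    rw [hstep]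
    refine ⟨⟨hspan'.trans hbspan, ?_, ?_⟩, Or.inr ⟨?_, rfl⟩⟩
    · simp only
      rw [hgs']
      exact hbne
    · intro i j hij hj
      simp only at hj ⊢
      rw [hgs']
      rcases Nat.lt_or_ge s.pos j with hj' | hj'
      · have hip : i = p := Fin.ext (by simp only [hp]; omega)
        have hjq : j = q := Fin.ext (by simp only [hq]; omega)
        have hμ : gsCoeff b q p ^ 2 ≤ 1 / 4 := gsCoeff_sizeReduce_sq_le s.basis hlt
        rw [hip, hjq]
        nlinarith [mul_le_mul_of_nonneg_right hμ (sq_nonneg ‖gsVec b p‖), not_lt.1 hlov]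
      · rw [hgs]
        exact hnorm i j hij hj'
    · rw [← hpot]
      unfold gramPotential
      rw [gramDet_congr_of_gsVec_eq hgs']

/-- Termination: each pass lowers the potential, or keeps it and advances the counter. -/
theorem LLLState.Invariant.exists_halted {Λ : Submodule ℤ (Fin d → ℤ)} {s : LLLState N d}
    (hs : s.Invariant Λ) :
    ∃ t : ℕ, (LLLState.step^[t] s).Halted ∧ (LLLState.step^[t] s).Invariant Λ := by
  by_cases h : s.Halted
  · exact ⟨0, h, hs⟩
  · obtain ⟨hinv, hdec⟩ := hs.step h
    obtain ⟨t, ht⟩ := hinv.exists_halted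
    exact ⟨t + 1, by simpa only [Function.iterate_succ_apply] using ht⟩
termination_by (gramPotential s.basis, N - s.pos)
decreasing_by
  have hN : s.pos + 1 < N := not_not.1 h
  rcases hdec with hdec | ⟨h1, h2⟩
  · exact Prod.Lex.left _ _ hdec
  · rw [h1, h2]
    exact Prod.Lex.right _ (by omega)

/-- A nonzero vector of the lattice is at least as long as some Gram-Schmidt vector: pair it with
the last one that its coordinates involve. -/
theorem exists_norm_gsVec_le (b : Fin N → Fin d → ℤ) {x : Fin d → ℤ}
    (hx : x ∈ Submodule.span ℤ (Set.range b)) (hx0 : x ≠ 0) :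
    ∃ i, ‖gsVec b i‖ ≤ ‖toEuclid x‖ := by
  obtain ⟨c, hc⟩ := (Submodule.mem_span_range_iff_exists_fun ℤ).1 hx
  have hne : (Finset.univ.filter fun i => c i ≠ 0).Nonempty := by
    by_contra hcon
    apply hx0
    rw [Finset.not_nonempty_iff_eq_empty, Finset.filter_eq_empty_iff] at hcon
    rw [← hc]
    exact Finset.sum_eq_zero fun i hi => by
      rw [not_not.1 (hcon hi), zero_smul]
  obtain ⟨i, hi, hmax⟩ := Finset.exists_max_image _ id hne
  have hci : c i ≠ 0 := (Finset.mem_filter.1 hi).2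
  refine ⟨i, ?_⟩
  have hxsum : toEuclid x = ∑ j, (c j : ℝ) • toEuclid (b j) := by
    ext k
    simp [← hc, toEuclid]
  have hinner : inner ℝ (toEuclid x) (gsVec b i) = c i * ‖gsVec b i‖ ^ 2 := by
    rw [hxsum, sum_inner, Finset.sum_eq_single i]
    · rw [inner_smul_left, conj_trivial]
      congr 1
      exact inner_gramSchmidt_self_right (fun j => toEuclid (b j)) i
    · intro j _ hji
      rw [inner_smul_left, conj_trivial]
      rcases lt_or_gt_of_ne hji with h | h
      · rw [real_inner_comm]
        have : inner ℝ (gsVec b i) (toEuclid (b j)) = 0 :=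
          InnerProductSpace.gramSchmidt_inv_triangular ℝ (fun j => toEuclid (b j)) h
        rw [this, mul_zero]
      · have : c j = 0 := by
          by_contra hcj
          exact absurd (hmax j (Finset.mem_filter.2 ⟨Finset.mem_univ _, hcj⟩)) (not_le.2 h)
        simp [this]
    · simp
  have hcs := abs_real_inner_le_norm (toEuclid x) (gsVec b i)
  rw [hinner, abs_mul, abs_of_nonneg (sq_nonneg ‖gsVec b i‖)] at hcs
  have hc1 : (1 : ℝ) ≤ |(c i : ℝ)| := by exact_mod_cast Int.one_le_abs hci
  rcases (norm_nonneg (gsVec b i)).eq_or_lt with h0 | h0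
  · rw [← h0]
    exact norm_nonneg _
  · nlinarith [mul_le_mul_of_nonneg_right hc1 (sq_nonneg ‖gsVec b i‖)]

theorem LLLState.Invariant.norm_basis_zero_le [NeZero N] {Λ : Submodule ℤ (Fin d → ℤ)}
    {s : LLLState N d} (hs : s.Invariant Λ) (h : s.Halted) {x : Fin d → ℤ} (hx : x ∈ Λ)
    (hx0 : x ≠ 0) : ‖toEuclid (s.basis 0)‖ ^ 2 ≤ 2 ^ (N - 1) * ‖toEuclid x‖ ^ 2 := by
  have hN : 0 < N := Nat.pos_of_ne_zero (NeZero.ne N)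
  have hhalt : ¬ s.pos + 1 < N := h
  have hchain : ∀ (m : ℕ) (hm : m < N),
      ‖gsVec s.basis 0‖ ^ 2 ≤ 2 ^ m * ‖gsVec s.basis ⟨m, hm⟩‖ ^ 2 := by
    intro m
    induction m with
    | zero => intro hm; simp
    | succ m ih =>
      intro hm
      have h1 := ih (by omega)
      have h2 := hs.norm_le ⟨m, by omega⟩ ⟨m + 1, hm⟩ rfl (by simp only; omega)
      calc _ ≤ _ := h1
        _ ≤ 2 ^ m * (2 * ‖gsVec s.basis ⟨m + 1, hm⟩‖ ^ 2) := by gcongr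
        _ = _ := by ring
  have h0 : gsVec s.basis 0 = toEuclid (s.basis 0) := by
    refine gramSchmidt_eq_of_mem_span _ _ (by simp) ?_
    have hemp : Set.Iio (0 : Fin N) = ∅ := by
      ext j
      simp
    rw [hemp]
    simp
  rw [← hs.span_eq] at hx
  obtain ⟨i, hi⟩ := exists_norm_gsVec_le s.basis hx hx0
  rw [← h0]
  calc _ ≤ 2 ^ (i : ℕ) * ‖gsVec s.basis i‖ ^ 2 := hchain i i.2
    _ ≤ 2 ^ (N - 1) * ‖toEuclid x‖ ^ 2 := by
      gcongr
      · norm_num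
      · omega

/-- The LLL algorithm, run on linearly independent integer vectors, halts, and the first vector
that it returns is nonzero, lies in the lattice and is within the factor `2 ^ ((N - 1) / 2)` of
the shortest nonzero lattice vector. -/
theorem exists_LLLReturns [NeZero N] {b : Fin N → Fin d → ℤ}
    (hb : LinearIndependent ℝ fun j => toEuclid (b j)) :
    ∃ v ∈ Submodule.span ℤ (Set.range b), v ≠ 0 ∧ LLLReturns b v ∧
      ∀ x ∈ Submodule.span ℤ (Set.range b), x ≠ 0 →
        ‖toEuclid v‖ ^ 2 ≤ 2 ^ (N - 1) * ‖toEuclid x‖ ^ 2 := by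
  have hinit : LLLState.Invariant (Submodule.span ℤ (Set.range b))
      { basis := b, pos := 0 } :=
    ⟨rfl, fun i => InnerProductSpace.gramSchmidt_ne_zero i hb, fun i j hij hj => by
      simp only at hj
      omega⟩
  obtain ⟨t, hhalt, hinv⟩ := hinit.exists_halted
  have hmem : (LLLState.step^[t] { basis := b, pos := 0 }).basis 0 ∈
      Submodule.span ℤ (Set.range b) := by
    have := Submodule.subset_span (R := ℤ)
      (Set.mem_range_self (f := (LLLState.step^[t] { basis := b, pos := 0 }).basis) 0)
    rwa [hinv.span_eq] at this
  refine ⟨_, hmem, ?_, ⟨t, hhalt, rfl⟩, fun x hx hx0 => hinv.norm_basis_zero_le hhalt hx hx0⟩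
  intro h0
  have hself := inner_gramSchmidt_self_right
    (fun j => toEuclid ((LLLState.step^[t] { basis := b, pos := 0 }).basis j)) 0
  have hzero : toEuclid (0 : Fin d → ℤ) = 0 := by
    ext k
    simp [toEuclid]
  rw [h0, hzero, inner_zero_left] at hself
  exact hinv.gsVec_ne_zero 0 (norm_eq_zero.1 (pow_eq_zero_iff two_ne_zero |>.1 hself.symm))

end Reduction

/-! ### Lattice vectors of a subset sum problem -/

section SubsetSum

variable {n : ℕ}

theorem subsetSumCol_succ (B₀ : ℤ) (B : Fin n → ℤ) (j i : Fin (n + 1)) :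
    subsetSumCol B₀ B j i.succ = if i = j then 1 else 0 := by
  simp [subsetSumCol, subsetSumMatrix, Matrix.one_apply]

theorem linearIndependent_subsetSumCol (B₀ : ℤ) (B : Fin n → ℤ) :
    LinearIndependent ℝ fun j => toEuclid (subsetSumCol B₀ B j) := by
  rw [Fintype.linearIndependent_iff]
  intro g hg i
  have h := congrArg (fun v : EuclideanSpace ℝ (Fin (n + 2)) => v i.succ) hg
  simpa [toEuclid, subsetSumCol_succ] using h

theorem mem_subsetSumLattice_iff (B₀ : ℤ) (B : Fin n → ℤ) (x : Fin (n + 2) → ℤ) :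
    x ∈ subsetSumLattice B₀ B ↔ x 0 = x 1 * B₀ - ∑ i : Fin n, B i * x i.succ.succ := by
  unfold subsetSumLattice
  rw [Submodule.mem_span_range_iff_exists_fun]
  have hrow : ∀ c : Fin (n + 1) → ℤ, (∑ j, c j • subsetSumCol B₀ B j) 0 =
      c 0 * B₀ - ∑ i : Fin n, B i * c i.succ := by
    intro c
    simp [Fin.sum_univ_succ, subsetSumCol, subsetSumMatrix, sub_eq_add_neg, mul_comm]
  have hid : ∀ (c : Fin (n + 1) → ℤ) (i : Fin (n + 1)),
      (∑ j, c j • subsetSumCol B₀ B j) i.succ = c i := by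
    intro c i
    simp [subsetSumCol_succ]
  constructor
  · rintro ⟨c, rfl⟩
    rw [hrow, ← Fin.succ_zero_eq_one, hid]
    simp only [hid]
  · intro hx
    refine ⟨fun j => x j.succ, funext fun i => ?_⟩
    refine Fin.cases ?_ (fun i => ?_) i
    · rw [hrow, hx, Fin.succ_zero_eq_one]
    · exact hid _ i

theorem solutionVec_mem (e B : Fin n → ℤ) :
    solutionVec e ∈ subsetSumLattice (∑ i, B i * e i) B := by
  rw [mem_subsetSumLattice_iff, ← Fin.succ_zero_eq_one]
  simp [solutionVec]

theorem solutionVec_ne_zero (e : Fin n → ℤ) : solutionVec e ≠ 0 := by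
  intro h
  have := congrFun h (Fin.succ 0)
  simp [solutionVec] at this

theorem norm_solutionVec_sq_le {e : Fin n → ℤ} (he : ∀ i, e i = 0 ∨ e i = 1) :
    ‖toEuclid (solutionVec e)‖ ^ 2 ≤ n + 1 := by
  rw [EuclideanSpace.norm_sq_eq, Fin.sum_univ_succ, Fin.sum_univ_succ]
  have h : ∑ i : Fin n, ‖toEuclid (solutionVec e) i.succ.succ‖ ^ 2 ≤ ∑ _i : Fin n, (1 : ℝ) := by
    refine Finset.sum_le_sum fun i _ => ?_
    rcases he i with h | h <;> simp [toEuclid, solutionVec, h]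
  have h0 : toEuclid (solutionVec e) 0 = 0 := by simp [toEuclid, solutionVec]
  have h1 : toEuclid (solutionVec e) (Fin.succ 0) = 1 := by simp [toEuclid, solutionVec]
  rw [h0, h1]
  simp at h ⊢
  linarith

/-- If every lattice vector within the LLL approximation bound is a multiple of the solution
vector, then LLL returns such a multiple. -/
theorem exists_LLLReturns_smul_solutionVec (hn : n ≠ 0) {e : Fin n → ℤ}
    (he : ∀ i, e i = 0 ∨ e i = 1) (B : Fin n → ℤ)
    (h : ∀ x ∈ subsetSumLattice (∑ i, B i * e i) B,
      ‖toEuclid x‖ ≤ 2 * (2 : ℝ) ^ ((n : ℝ) / 2) * √(n : ℝ) → ∃ k : ℤ, x = k • solutionVec e) :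
    ∃ k : ℤ, k ≠ 0 ∧ LLLReturns (subsetSumCol (∑ i, B i * e i) B) (k • solutionVec e) := by
  obtain ⟨v, hv, hv0, hret, hle⟩ :=
    exists_LLLReturns (linearIndependent_subsetSumCol (∑ i, B i * e i) B)
  have hbound := hle _ (solutionVec_mem e B) (solutionVec_ne_zero e)
  obtain ⟨k, rfl⟩ := h v hv (by
    refine le_of_sq_le_sq ?_ (by positivity)
    have hpow : ((2 : ℝ) ^ ((n : ℝ) / 2)) ^ 2 = 2 ^ n := by
      rw [← Real.rpow_natCast, ← Real.rpow_mul (by norm_num), Nat.cast_ofNat,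
        div_mul_cancel₀ _ (by norm_num), Real.rpow_natCast]
    rw [mul_pow, mul_pow, hpow, Real.sq_sqrt (Nat.cast_nonneg n)]
    have hn1 : (1 : ℝ) ≤ n := by exact_mod_cast Nat.one_le_iff_ne_zero.2 hn
    calc ‖toEuclid v‖ ^ 2 ≤ 2 ^ n * ‖toEuclid (solutionVec e)‖ ^ 2 := hbound
      _ ≤ 2 ^ n * (n + 1) := by
        gcongr
        exact norm_solutionVec_sq_le he
      _ ≤ 2 ^ n * (4 * n) := by
        gcongr
        linarith
      _ = 2 ^ 2 * 2 ^ n * n := by ring)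
  refine ⟨k, ?_, hret⟩
  rintro rfl
  exact hv0 (zero_smul _ _)

/-- A lattice vector which is not a multiple of the solution vector gives a nontrivial linear
relation with the coefficients `x₀ e_i - x_i`. -/
theorem exists_coeff_ne_zero_of_mem {e B : Fin n → ℤ} {x : Fin (n + 2) → ℤ}
    (hx : x ∈ subsetSumLattice (∑ i, B i * e i) B) (hk : ¬ ∃ k : ℤ, x = k • solutionVec e) :
    (∃ i : Fin n, x 1 * e i - x i.succ.succ ≠ 0) ∧
      ∑ i : Fin n, B i * (x 1 * e i - x i.succ.succ) = x 0 := by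
  rw [mem_subsetSumLattice_iff] at hx
  have hrel : ∑ i : Fin n, B i * (x 1 * e i - x i.succ.succ) = x 0 := by
    rw [hx, Finset.mul_sum, ← Finset.sum_sub_distrib]
    exact Finset.sum_congr rfl fun i _ => by ring
  refine ⟨?_, hrel⟩
  by_contra! hall
  refine hk ⟨x 1, funext fun i => ?_⟩
  refine Fin.cases ?_ (fun i => Fin.cases ?_ (fun i => ?_) i) i
  · rw [← hrel]
    simp [hall, solutionVec]
  · simp [solutionVec]
  · simpa [solutionVec] using (sub_eq_zero.1 (hall i)).symm

theorem abs_apply_le_norm_toEuclid {d : ℕ} (x : Fin d → ℤ) (i : Fin d) :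
    |(x i : ℝ)| ≤ ‖toEuclid x‖ := by
  simpa [toEuclid] using PiLp.norm_apply_le (toEuclid x) i

end SubsetSum

/-! ### The probability of a linear relation -/

section Probability

variable {Ω : Type*} [MeasurableSpace Ω] {P : Measure Ω} [IsProbabilityMeasure P]

/-- Adding an independent variable does not increase the largest point mass. -/
theorem measure_add_eq_le_of_indepFun {X Y : Ω → ℤ} (hX : Measurable X) (hY : Measurable Y)
    (hXY : IndepFun X Y P) {δ : ENNReal} (hδ : ∀ c, P {ω | Y ω = c} ≤ δ) (y : ℤ) :
    P {ω | X ω + Y ω = y} ≤ δ := by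
  have : IsProbabilityMeasure (P.map X) := Measure.isProbabilityMeasure_map hX.aemeasurable
  have hset : MeasurableSet {p : ℤ × ℤ | p.1 + p.2 = y} := MeasurableSet.of_discrete
  have h1 : P {ω | X ω + Y ω = y} = P.map (fun ω => (X ω, Y ω)) {p : ℤ × ℤ | p.1 + p.2 = y} := by
    rw [Measure.map_apply (hX.prodMk hY) hset]
    rfl
  have : IsProbabilityMeasure (P.map Y) := Measure.isProbabilityMeasure_map hY.aemeasurable
  rw [h1, (indepFun_iff_map_prod_eq_prod_map_map hX.aemeasurable hY.aemeasurable).1 hXY,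
    Measure.prod_apply hset]
  calc _ ≤ ∫⁻ _, δ ∂(P.map X) := by
        refine lintegral_mono fun s => ?_
        rw [Measure.map_apply hY MeasurableSet.of_discrete]
        refine le_trans (measure_mono ?_) (hδ (y - s))
        intro ω hω
        have hω' : s + Y ω = y := hω
        simp only [Set.mem_ofPred_eq]
        omega
    _ = δ := by simp

theorem uniformOn_Icc_singleton_le (K b : ℕ) : uniformOn (Set.Icc 1 K) {b} ≤ (K : ENNReal)⁻¹ := by
  rw [uniformOn, cond_apply measurableSet_Icc, ← Finset.coe_Icc, Measure.count_apply_finset,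
    Nat.card_Icc, Nat.add_sub_cancel]
  refine mul_le_of_le_one_right' ?_
  calc _ ≤ Measure.count {b} := measure_mono Set.inter_subset_right
    _ = 1 := Measure.count_singleton b

theorem measure_sum_mul_eq_le {n K : ℕ} {B : Fin n → Ω → ℕ} (hB : ∀ i, Measurable (B i))
    (hind : iIndepFun B P) (hunif : ∀ i, P.map (B i) = uniformOn (Set.Icc 1 K))
    {z : Fin n → ℤ} {k : Fin n} (hz : z k ≠ 0) (y : ℤ) :
    P {ω | ∑ i, (B i ω : ℤ) * z i = y} ≤ (K : ENNReal)⁻¹ := by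
  set f : Fin n → Ω → ℤ := fun i ω => (B i ω : ℤ) * z i with hf
  have hfm : ∀ i, Measurable (f i) := fun i =>
    (Measurable.of_discrete (f := fun b : ℕ => (b : ℤ) * z i)).comp (hB i)
  have hfind : iIndepFun f P :=
    hind.comp (fun i (b : ℕ) => (b : ℤ) * z i) fun i => Measurable.of_discrete
  have hpair := hfind.indepFun_finsetSum_of_notMem hfm (Finset.notMem_erase k Finset.univ)
  have hsum : ∀ ω, ∑ i, (B i ω : ℤ) * z i = (∑ i ∈ Finset.univ.erase k, f i) ω + f k ω := by
    intro ω
    rw [Finset.sum_apply, Finset.sum_erase_add _ _ (Finset.mem_univ k)]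
  simp only [hsum]
  have hrest : Measurable (∑ i ∈ Finset.univ.erase k, f i) := by
    rw [Finset.sum_fn]
    exact Finset.measurable_sum _ fun i _ => hfm i
  refine measure_add_eq_le_of_indepFun hrest (hfm k) hpair (fun c => ?_) y
  calc P {ω | f k ω = c} ≤ P (B k ⁻¹' {(c / z k).toNat}) := by
        refine measure_mono fun ω hω => ?_
        have hω' : (B k ω : ℤ) * z k = c := hω
        simp [← hω', Int.mul_ediv_cancel _ hz]
    _ = uniformOn (Set.Icc 1 K) {(c / z k).toNat} := by
        rw [← hunif k, Measure.map_apply (hB k) (measurableSet_singleton _)]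
    _ ≤ _ := uniformOn_Icc_singleton_le K _

/-- Union bound over the integer points of a cube that contains the ball of radius `m`. -/
theorem measureReal_exists_short_vector_le {n K : ℕ} {B : Fin n → Ω → ℕ}
    (hB : ∀ i, Measurable (B i)) (hind : iIndepFun B P)
    (hunif : ∀ i, P.map (B i) = uniformOn (Set.Icc 1 K)) (hK : K ≠ 0)
    (e : Fin n → ℤ) {m : ℝ} (hm : 0 ≤ m) :
    P.real {ω | ∃ x ∈ subsetSumLattice (∑ i, (B i ω : ℤ) * e i) (fun i => (B i ω : ℤ)),
      ‖toEuclid x‖ ≤ m ∧ ¬ ∃ k : ℤ, x = k • solutionVec e} ≤ (2 * m + 1) ^ (n + 2) / K := by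
  classical
  set box : Finset (Fin (n + 2) → ℤ) :=
    Fintype.piFinset fun _ => Finset.Icc (-(⌊m⌋₊ : ℤ)) ⌊m⌋₊ with hbox
  set bad : Finset (Fin (n + 2) → ℤ) :=
    box.filter fun x => ∃ i : Fin n, x 1 * e i - x i.succ.succ ≠ 0 with hbad
  have hsub : {ω | ∃ x ∈ subsetSumLattice (∑ i, (B i ω : ℤ) * e i) (fun i => (B i ω : ℤ)),
      ‖toEuclid x‖ ≤ m ∧ ¬ ∃ k : ℤ, x = k • solutionVec e} ⊆
      ⋃ x ∈ bad, {ω | ∑ i : Fin n, (B i ω : ℤ) * (x 1 * e i - x i.succ.succ) = x 0} := by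
    rintro ω ⟨x, hx, hxm, hk⟩
    obtain ⟨hz, hrel⟩ := exists_coeff_ne_zero_of_mem hx hk
    refine Set.mem_biUnion (x := x) ?_ hrel
    refine Finset.mem_filter.2 ⟨Fintype.mem_piFinset.2 fun i => ?_, hz⟩
    have habs : (x i).natAbs ≤ ⌊m⌋₊ := by
      refine Nat.le_floor (le_trans (le_of_eq ?_) ((abs_apply_le_norm_toEuclid x i).trans hxm))
      rw [Nat.cast_natAbs, Int.cast_abs]
    rw [Finset.mem_Icc]
    omega
  have hcard : (bad.card : ℝ) ≤ (2 * m + 1) ^ (n + 2) := by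
    have h1 : bad.card ≤ (2 * ⌊m⌋₊ + 1) ^ (n + 2) := by
      refine (Finset.card_filter_le _ _).trans (le_of_eq ?_)
      rw [hbox, Fintype.card_piFinset]
      simp only [Int.card_Icc, Finset.prod_const, Finset.card_univ, Fintype.card_fin]
      congr 1
      omega
    calc (bad.card : ℝ) ≤ (2 * (⌊m⌋₊ : ℝ) + 1) ^ (n + 2) := by exact_mod_cast h1
      _ ≤ _ := by
        gcongr
        exact Nat.floor_le hm
  have hP : P {ω | ∃ x ∈ subsetSumLattice (∑ i, (B i ω : ℤ) * e i) (fun i => (B i ω : ℤ)),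
      ‖toEuclid x‖ ≤ m ∧ ¬ ∃ k : ℤ, x = k • solutionVec e} ≤ bad.card * (K : ENNReal)⁻¹ := by
    refine (measure_mono hsub).trans ((measure_biUnion_finset_le _ _).trans ?_)
    rw [← nsmul_eq_mul]
    refine Finset.sum_le_card_nsmul _ _ _ fun x hx => ?_
    obtain ⟨k, hk⟩ := (Finset.mem_filter.1 hx).2
    exact measure_sum_mul_eq_le (z := fun i => x 1 * e i - x i.succ.succ) hB hind hunif hk _
  have hfin : (bad.card * (K : ENNReal)⁻¹ : ENNReal) ≠ ⊤ :=
    ENNReal.mul_ne_top (ENNReal.natCast_ne_top _) (by simpa using hK)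
  calc _ ≤ (bad.card * (K : ENNReal)⁻¹ : ENNReal).toReal := ENNReal.toReal_mono hfin hP
    _ = bad.card / K := by simp [div_eq_mul_inv]
    _ ≤ _ := by gcongr

end Probability

/-! ### The number of short vectors -/

/-- The exponent is `n² / 2 + O(n log n)`, and the error term is absorbed by `ε n² / 2`. -/
theorem exists_pow_le_const_mul_rpow {ε : ℝ} (hε : 0 < ε) :
    ∃ C : ℝ, 0 < C ∧ ∀ n : ℕ, (2 * (2 * (2 : ℝ) ^ ((n : ℝ) / 2) * √(n : ℝ)) + 1) ^ (n + 2) ≤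
      C * (2 : ℝ) ^ ((1 / 2 + ε / 2) * (n : ℝ) ^ 2) := by
  set r : ℝ := (2 : ℝ) ^ (ε / 4) with hr
  have hr1 : 1 < r := Real.one_lt_rpow (by norm_num) (by positivity)
  obtain ⟨A₀, hA₀⟩ : ∃ A₀ : ℝ, ∀ n : ℕ, (n : ℝ) / r ^ n ≤ A₀ := by
    have ht := tendsto_pow_const_div_const_pow_of_one_lt 1 hr1
    simp only [pow_one] at ht
    obtain ⟨A₀, h⟩ := ht.bddAbove_range
    exact ⟨A₀, fun n => h ⟨n, rfl⟩⟩
  -- `2 ^ a` bounds the subexponential factor `4 √n + 1` up to `r ^ n`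
  obtain ⟨a, ha⟩ : ∃ a : ℝ, 4 * A₀ + 5 = (2 : ℝ) ^ a := by
    have h0 : 0 ≤ A₀ := by simpa using hA₀ 0
    exact ⟨Real.logb 2 (4 * A₀ + 5),
      (Real.rpow_logb (by norm_num) (by norm_num) (by linarith)).symm⟩
  have hbase : ∀ n : ℕ, 2 * (2 * (2 : ℝ) ^ ((n : ℝ) / 2) * √(n : ℝ)) + 1 ≤
      (2 : ℝ) ^ (a + (n : ℝ) / 2 + ε / 4 * n) := by
    intro n
    have hrn : (2 : ℝ) ^ (ε / 4 * n) = r ^ n := by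
      rw [hr, Real.rpow_mul (by norm_num), Real.rpow_natCast]
    have hrn1 : 1 ≤ r ^ n := one_le_pow₀ hr1.le
    have h2n : (1 : ℝ) ≤ (2 : ℝ) ^ ((n : ℝ) / 2) :=
      Real.one_le_rpow (by norm_num) (by positivity)
    have hsqrt : √(n : ℝ) ≤ n + 1 := by
      rw [Real.sqrt_le_left (by positivity)]
      nlinarith [Nat.cast_nonneg (α := ℝ) n]
    have hn : (n : ℝ) ≤ A₀ * r ^ n := (div_le_iff₀ (by positivity)).1 (hA₀ n)
    rw [Real.rpow_add (by norm_num), Real.rpow_add (by norm_num), hrn, ← ha]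
    calc 2 * (2 * (2 : ℝ) ^ ((n : ℝ) / 2) * √(n : ℝ)) + 1
        ≤ 2 * (2 * (2 : ℝ) ^ ((n : ℝ) / 2) * (A₀ * r ^ n + r ^ n)) +
          (2 : ℝ) ^ ((n : ℝ) / 2) * r ^ n := by
          gcongr
          · linarith
          · nlinarith
      _ = _ := by ring
  set c : ℝ := a + 1 + ε / 2 with hc
  refine ⟨(2 : ℝ) ^ (2 * a + c ^ 2 / ε), by positivity, fun n => ?_⟩
  calc _ ≤ ((2 : ℝ) ^ (a + (n : ℝ) / 2 + ε / 4 * n)) ^ (n + 2) := by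
        gcongr
        exact hbase n
    _ = (2 : ℝ) ^ ((a + (n : ℝ) / 2 + ε / 4 * n) * (n + 2)) := by
        rw [← Real.rpow_natCast, ← Real.rpow_mul (by norm_num)]
        push_cast
        rfl
    _ ≤ (2 : ℝ) ^ (2 * a + c ^ 2 / ε + (1 / 2 + ε / 2) * (n : ℝ) ^ 2) := by
        refine Real.rpow_le_rpow_of_exponent_le (by norm_num) ?_
        -- completing the square: `c n ≤ ε n² / 4 + c² / ε`
        have hsq : c * n ≤ ε / 4 * (n : ℝ) ^ 2 + c ^ 2 / ε := by
          have h := sq_nonneg (ε * n / 2 - c)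
          have h2 : ε / 4 * (n : ℝ) ^ 2 + c ^ 2 / ε - c * n = (ε * n / 2 - c) ^ 2 / ε := by
            field_simp
            ring
          have h3 : 0 ≤ (ε * n / 2 - c) ^ 2 / ε := by positivity
          linarith
        rw [hc] at hsq ⊢
        linarith
    _ = _ := Real.rpow_add (by norm_num) _ _

/-! ### LLL solves almost all subset sum problems of low density -/

theorem mainTheorem2 (ε : ℝ) (hε : 0 < ε) :
    ∃ C : ℝ, 0 < C ∧
      ∀ (n : ℕ) (e : Fin n → ℤ), (∀ i, e i = 0 ∨ e i = 1) →
      ∀ {Ω : Type*} [MeasurableSpace Ω] (P : Measure Ω) [IsProbabilityMeasure P]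
        (B : Fin n → Ω → ℕ), (∀ i, Measurable (B i)) → iIndepFun B P →
        (∀ i, P.map (B i) =
          uniformOn (Set.Icc 1 ⌊(2 : ℝ) ^ ((1 / 2 + ε) * (n : ℝ) ^ 2)⌋₊)) →
        P.real {ω | ¬ ∃ k : ℤ, k ≠ 0 ∧
            LLLReturns
              (subsetSumCol (∑ i, (B i ω : ℤ) * e i) (fun i => (B i ω : ℤ)))
              (k • solutionVec e)}
          ≤ C * (2 : ℝ) ^ (-(ε * (n : ℝ) ^ 2 / 2)) ∧
        P.real {ω | ∃ x ∈ subsetSumLattice (∑ i, (B i ω : ℤ) * e i) (fun i => (B i ω : ℤ)),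
            ‖toEuclid x‖ ≤ 2 * (2 : ℝ) ^ ((n : ℝ) / 2) * √(n : ℝ) ∧
            ¬ ∃ k : ℤ, x = k • solutionVec e}
          ≤ C * (2 : ℝ) ^ (-(ε * (n : ℝ) ^ 2 / 2)) := by
  obtain ⟨C₀, hC₀, hcount⟩ := exists_pow_le_const_mul_rpow hε
  refine ⟨2 * C₀ + 1, by positivity, ?_⟩
  intro n e he Ω _ P _ B hB hind hunif
  set T : ℝ := (2 : ℝ) ^ ((1 / 2 + ε) * (n : ℝ) ^ 2) with hT
  have hT1 : 1 ≤ T := Real.one_le_rpow (by norm_num) (by positivity)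
  have hK : ⌊T⌋₊ ≠ 0 := (Nat.floor_pos.2 hT1).ne'
  have hKT : T / 2 ≤ ⌊T⌋₊ := by
    have h1 : T < ⌊T⌋₊ + 1 := Nat.lt_floor_add_one T
    have h2 : (1 : ℝ) ≤ ⌊T⌋₊ := by exact_mod_cast Nat.one_le_iff_ne_zero.2 hK
    linarith
  have hshort : P.real {ω | ∃ x ∈ subsetSumLattice (∑ i, (B i ω : ℤ) * e i)
        (fun i => (B i ω : ℤ)), ‖toEuclid x‖ ≤ 2 * (2 : ℝ) ^ ((n : ℝ) / 2) * √(n : ℝ) ∧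
          ¬ ∃ k : ℤ, x = k • solutionVec e} ≤
      (2 * C₀ + 1) * (2 : ℝ) ^ (-(ε * (n : ℝ) ^ 2 / 2)) := by
    refine (measureReal_exists_short_vector_le hB hind hunif hK e (by positivity)).trans ?_
    calc _ ≤ C₀ * (2 : ℝ) ^ ((1 / 2 + ε / 2) * (n : ℝ) ^ 2) / (T / 2) := by
          gcongr
          exact hcount n
      _ = 2 * C₀ * (2 : ℝ) ^ (-(ε * (n : ℝ) ^ 2 / 2)) := by
          have hsplit : (2 : ℝ) ^ ((1 / 2 + ε / 2) * (n : ℝ) ^ 2) =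
              T * (2 : ℝ) ^ (-(ε * (n : ℝ) ^ 2 / 2)) := by
            rw [hT, ← Real.rpow_add (by norm_num)]
            ring_nf
          rw [hsplit]
          field_simp
      _ ≤ _ := by
          gcongr
          linarith
  refine ⟨?_, hshort⟩
  rcases eq_or_ne n 0 with rfl | hn
  · -- the approximation bound is `0` for `n = 0`, but there the claimed bound exceeds `1`
    refine measureReal_le_one.trans ?_
    simp
    linarith
  · refine (measureReal_mono (fun ω hω => ?_)).trans hshort
    by_contra hcon
    refine hω (exists_LLLReturns_smul_solutionVec hn he (fun i => (B i ω : ℤ)) ?_)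
    intro x hx hxm
    by_contra hk
    exact hcon ⟨x, hx, hxm, hk⟩
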